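/- **Setting.** Let $G$ be a 3-dimensional Lie group with Lie algebra $\mathfrak g$ and a left-invariant Riemannian metric $g$. Let $\nabla$ be the Levi-Civita connection of $g$. Fix a $g$-orthonormal basis $(e_1,e_2,e_3)$ of $\mathfrak g$ (which fixes an orientation), and denote the corresponding left-invariant vector fields by the same symbols. Put $x=\tfrac1{\sqrt2}(e_2-ie_3)$, $y=\tfrac1{\sqrt2}(e_2+ie_3)$ in $\mathfrak g^{\mathbb C}$, and let $\Sigma=\Lambda^\bullet(\mathbb C y)$ be the spin module, with Clifford multiplication $$e_1\cdot\eta=i(\eta_{\rm even}-\eta_{\rm odd}),\qquad e_2\cdot\eta=i(x\lrcorner\eta+y\wedge\eta),\qquad e_3\cdot\eta=y\wedge\eta-x\lrcorner\eta .$$ The spinor bundle of the $G$-invariant spin structure is $G\times\Sigma$. A spinor is a smooth map $\psi\colon G\to\Sigma$; its spin covariant derivative is $$\widetilde\nabla_X\psi=d\psi(X)+\tfrac12\sum_{i<j}g(\nabla_Xe_i,e_j)\,e_i\cdot e_j\cdot\psi .$$ A spinor $\psi$ is *invariant* if $\psi(a^{-1}b)=\psi(b)$ for all $a,b\in G$,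 that is, if it is constant; thus invariant spinors are identified with elements of $\Sigma$. A spinor $\psi$ is *generalised Killing with endomorphism $A$* if $A$ is a smooth field of $g$-symmetric endomorphisms of $TG$ and $\widetilde\nabla_X\psi=A(X)\cdot\psi$ for every tangent vector $X$. **Lemma 4.1.** Suppose that some non-zero invariant spinor is generalised Killing with endomorphism $A$. Then every invariant spinor is generalised Killing with the same endomorphism $A$. Hence the set of invariant generalised Killing spinors (each with some endomorphism) is, as a subset of $\Sigma$, a complex vector subspace, and it is either $0$ or all of $\Sigma$. -/

import Mathlib

open Bundle
open scoped Manifold ContDiff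

namespace LieSpin

noncomputable section

/-! ### The spin representation in dimension three

With respect to an orthonormal basis `e₁, e₂, e₃` of the Lie algebra (indexed below by `0, 1, 2`),
put `x = (e₂ - i e₃) / √2` and `y = (e₂ + i e₃) / √2`.  The spin module is `Σ = Λ^• L'`, where `L'`
is the complex line spanned by `y`.  The line `L'` is identified with `ℂ` by `y ↔ 1`; the
functional `z ↦ B(x, z)` on `L'` is then the identity of `ℂ`, because `B(x, y) = 1`. -/

/-- The spin module `Σ = Λ^• L'`, with `L' = ℂ y`. -/
abbrev SpinModule : Type := ExteriorAlgebra ℂ ℂ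

/-- Coordinates on `Σ` with respect to its complex basis `1, y`. -/
def spinCoord : SpinModule →ₗ[ℂ] ℂ × ℂ where
  toFun η := ((CliffordAlgebraDualNumber.equiv (R := ℂ) η).fst,
    (CliffordAlgebraDualNumber.equiv (R := ℂ) η).snd)
  map_add' _ _ := by simp
  map_smul' _ _ := by simp

theorem spinCoord_injective : Function.Injective spinCoord := by
  intro a b h
  simp only [spinCoord, LinearMap.coe_mk, AddHom.coe_mk, Prod.mk.injEq] at h
  exact (CliffordAlgebraDualNumber.equiv (R := ℂ)).injective (TrivSqZeroExt.ext h.1 h.2)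

/-- A norm on the finite-dimensional space `Σ`, which is used only to differentiate maps into it
(all norms on `Σ` give the same derivatives). -/
instance : NormedAddCommGroup SpinModule :=
  NormedAddCommGroup.induced SpinModule (ℂ × ℂ) spinCoord spinCoord_injective

instance : NormedSpace ℂ SpinModule :=
  NormedSpace.induced ℂ SpinModule (ℂ × ℂ) spinCoord

/-- `y ∧ η`. -/
def wedgeY : SpinModule →ₗ[ℂ] SpinModule :=
  LinearMap.mulLeft ℂ (ExteriorAlgebra.ι ℂ (1 : ℂ))

/-- The interior product `x ⌟ η`. -/
def contractX : SpinModule →ₗ[ℂ] SpinModule :=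
  CliffordAlgebra.contractLeft (LinearMap.id : Module.Dual ℂ ℂ)

/-- `η ↦ η_even - η_odd`. -/
def gradeSign : SpinModule →ₗ[ℂ] SpinModule :=
  (CliffordAlgebra.involute (Q := (0 : QuadraticForm ℂ ℂ))).toLinearMap

/-- Clifford multiplication by the vectors `e₁, e₂, e₃` of the orthonormal basis:
`e₁ · η = i (η_even - η_odd)`, `e₂ · η = i (x ⌟ η + y ∧ η)`, `e₃ · η = y ∧ η - x ⌟ η`. -/
def gammaMap : Fin 3 → (SpinModule →ₗ[ℂ] SpinModule) :=
  ![Complex.I • gradeSign, Complex.I • (contractX + wedgeY), wedgeY - contractX]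

/-! ### Spinor fields and the Levi-Civita connection on a three-dimensional Lie group -/

section Group

variable {G : Type*} [TopologicalSpace G] [ChartedSpace (EuclideanSpace ℝ (Fin 3)) G] [Group G]

/-- The action of `G` on spinors, that is, on sections of the trivial bundle `G × Σ`:
`(x · ψ)(y) = ψ (x⁻¹ y)`. -/
def translate (x : G) (ψ : G → SpinModule) : G → SpinModule := fun y => ψ (x⁻¹ * y)

/-- A spinor is invariant if it is stabilised by every element of `G`. -/
def IsInvariantSpinor (ψ : G → SpinModule) : Prop := ∀ x : G, translate x ψ = ψ

variable [LieGroup (𝓡 3) ∞ G]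

set_option synthInstance.maxHeartbeats 200000 in
instance instIsManifoldTwo : IsManifold (𝓡 3) 2 G := inferInstance

set_option synthInstance.maxHeartbeats 200000 in
instance instIsManifoldOne : IsManifold (𝓡 3) 1 G := inferInstance

/-- A smooth Riemannian metric on `G`. -/
abbrev Metric (G : Type*) [TopologicalSpace G] [ChartedSpace (EuclideanSpace ℝ (Fin 3)) G]
    [Group G] [LieGroup (𝓡 3) ∞ G] : Type _ :=
  ContMDiffRiemannianMetric (𝓡 3) ∞ (EuclideanSpace ℝ (Fin 3))
    (fun x : G => TangentSpace (𝓡 3) x)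

/-- An affine connection on `G`: a covariant derivative on the tangent bundle, where
`D Y x v` stands for `(D_v Y)(x)`. -/
abbrev Connection (G : Type*) [TopologicalSpace G] [ChartedSpace (EuclideanSpace ℝ (Fin 3)) G]
    [Group G] [LieGroup (𝓡 3) ∞ G] : Type _ :=
  CovariantDerivative (𝓡 3) (EuclideanSpace ℝ (Fin 3)) (fun x : G => TangentSpace (𝓡 3) x)

/-- The Riemannian metric `g` is left-invariant: left translations are isometries. -/
def IsLeftInvariantMetric (g : Metric G) : Prop :=
  ∀ (a x : G) (v w : TangentSpace (𝓡 3) x),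
    g.inner (a * x) (mfderiv (𝓡 3) (𝓡 3) (a * ·) x v) (mfderiv (𝓡 3) (𝓡 3) (a * ·) x w) =
      g.inner x v w

/-- `D` is compatible with the metric `g`. -/
def IsMetricConnection (g : Metric G) (D : Connection G) : Prop :=
  letI : RiemannianBundle (fun x : G => TangentSpace (𝓡 3) x) := ⟨g.toRiemannianMetric⟩
  haveI : IsContMDiffRiemannianBundle (𝓡 3) 1 (EuclideanSpace ℝ (Fin 3))
    (fun x : G => TangentSpace (𝓡 3) x) := IsContMDiffRiemannianBundle.of_le (n := ∞) (by simp)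
  CovariantDerivative.IsMetricCompatible D

/-- `D` is the Levi-Civita connection of `g`: it is compatible with `g` and torsion-free. -/
structure IsLeviCivita (g : Metric G) (D : Connection G) : Prop where
  metric : IsMetricConnection g D
  torsion_free : D.torsion = 0

/-! ### The spin connection and generalised Killing spinors

Throughout, `e` is a `g`-orthonormal basis of the Lie algebra `T₁G`; it determines the orientation
of `G` and the identification of the spinor bundle of the invariant spin structure with `G × Σ`. -/

/-- `e` is orthonormal for the inner product `g₁` on the Lie algebra `T₁G`.  As the Lie algebra is
three-dimensional, `e` is then an orthonormal basis of it. -/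
def IsOrthonormal (g : Metric G) (e : Fin 3 → GroupLieAlgebra (𝓡 3) G) : Prop :=
  ∀ i j : Fin 3, g.inner 1 (e i) (e j) = if i = j then 1 else 0

/-- The left-invariant vector field with value `e i` at the identity. -/
def frame (e : Fin 3 → GroupLieAlgebra (𝓡 3) G) (i : Fin 3) (x : G) : TangentSpace (𝓡 3) x :=
  mulInvariantVectorField (e i) x

/-- Clifford multiplication `v · s` of `s ∈ Σ` by a tangent vector `v` at `x`. -/
def cliffordMul (g : Metric G) (e : Fin 3 → GroupLieAlgebra (𝓡 3) G) (x : G)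
    (v : TangentSpace (𝓡 3) x) (s : SpinModule) : SpinModule :=
  ∑ i : Fin 3, ((g.inner x v (frame e i x) : ℝ) : ℂ) • gammaMap i s

/-- The differential of `ψ : G → Σ` at `x` in the direction `v`. -/
def spinorDeriv (ψ : G → SpinModule) (x : G) (v : TangentSpace (𝓡 3) x) : SpinModule :=
  mfderiv (𝓡 3) 𝓘(ℝ, SpinModule) ψ x v

/-- The spin connection on `G × Σ` induced by a metric connection `D` on `TG`.  For a tangent
vector `v` at `x` it is `dψ(v) + 1/2 ∑_{i<j} g(D_v eᵢ, eⱼ) eᵢ · eⱼ · ψ(x)`, where the `eᵢ` are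
extended to left-invariant vector fields; that is, the connection form of `D` in this frame is
lifted by the isomorphism `𝔰𝔬(3) → 𝔰𝔭𝔦𝔫(3)`, `eᵢ ∧ eⱼ ↦ 1/2 eᵢ · eⱼ`. -/
def spinConnection (g : Metric G) (D : Connection G) (e : Fin 3 → GroupLieAlgebra (𝓡 3) G)
    (ψ : G → SpinModule) (x : G) (v : TangentSpace (𝓡 3) x) : SpinModule :=
  spinorDeriv ψ x v +
    (1 / 2 : ℂ) • ∑ i : Fin 3, ∑ j ∈ Finset.Ioi i,
      ((g.inner x (D (frame e i) x v) (frame e j x) : ℝ) : ℂ) • gammaMap i (gammaMap j (ψ x))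

/-- An endomorphism field of the tangent bundle of `G`. -/
abbrev EndField (G : Type*) [TopologicalSpace G] [ChartedSpace (EuclideanSpace ℝ (Fin 3)) G] :
    Type _ :=
  (x : G) → TangentSpace (𝓡 3) x →L[ℝ] TangentSpace (𝓡 3) x

/-- The endomorphism field `A` is a smooth section of `End(TG)`. -/
def IsSmoothEndField (A : EndField G) : Prop :=
  ContMDiff (𝓡 3)
    ((𝓡 3).prod 𝓘(ℝ, EuclideanSpace ℝ (Fin 3) →L[ℝ] EuclideanSpace ℝ (Fin 3))) ∞
    (fun x : G => (TotalSpace.mk' (EuclideanSpace ℝ (Fin 3) →L[ℝ] EuclideanSpace ℝ (Fin 3)) x (A x) :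
        TotalSpace (EuclideanSpace ℝ (Fin 3) →L[ℝ] EuclideanSpace ℝ (Fin 3))
          (fun x : G => TangentSpace (𝓡 3) x →L[ℝ] TangentSpace (𝓡 3) x)))

/-- The spinor `ψ` is generalised Killing with endomorphism field `A`: `ψ` is smooth, `A` is a
smooth field of `g`-symmetric endomorphisms of `TG`, and the spin covariant derivative of `ψ` in
the direction of any tangent vector `v` is `A(v) · ψ`.  Here `D` is meant to be the Levi-Civita
connection of `g` and `e` an orthonormal basis of the Lie algebra. -/
structure IsGeneralisedKilling (g : Metric G) (D : Connection G)
    (e : Fin 3 → GroupLieAlgebra (𝓡 3) G) (ψ : G → SpinModule) (A : EndField G) : Prop where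
  smooth_spinor : ContMDiff (𝓡 3) 𝓘(ℝ, SpinModule) ∞ ψ
  smooth_endo : IsSmoothEndField A
  symmetric : ∀ (x : G) (v w : TangentSpace (𝓡 3) x), g.inner x (A x v) w = g.inner x v (A x w)
  equation : ∀ (x : G) (v : TangentSpace (𝓡 3) x),
    spinConnection g D e ψ x v = cliffordMul g e x (A x v) (ψ x)

end Group

end

end LieSpin

namespace LieSpin

/-! In dimension three the products `eᵢ · eⱼ` with `i ≠ j` act on spinors as `± eₖ`, so the
connection term of the spin derivative is Clifford multiplication by a real vector `b(v)`
(`half_sum_gammaMap_gammaMap`). On a constant spinor `s` the Killing equation thus reads `(b(v) -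
A(v)) · s = 0`. Non-zero real vectors act injectively (`eq_zero_of_sum_smul_gammaMap_eq_zero`), so
one `s ≠ 0` forces `A = b`. As `b` does not involve `s`, the equation then holds for every constant
spinor. -/

/-- Every element of the spin module is a combination of `1` and `y`. -/
theorem exists_eq_smul_one_add_smul_y (s : SpinModule) :
    ∃ a b : ℂ, s = a • (1 : SpinModule) + b • ExteriorAlgebra.ι ℂ (1 : ℂ) := by
  refine ⟨(spinCoord s).1, (spinCoord s).2, spinCoord_injective ?_⟩
  have h1 : CliffordAlgebraDualNumber.equiv (R := ℂ) (1 : SpinModule) = 1 := map_one _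
  have hy : CliffordAlgebraDualNumber.equiv (R := ℂ) (ExteriorAlgebra.ι ℂ (1 : ℂ)) =
      (DualNumber.eps : DualNumber ℂ) :=
    (CliffordAlgebraDualNumber.equiv_ι (R := ℂ) 1).trans (one_smul ℂ _)
  rw [map_add, map_smul, map_smul]
  ext <;> simp [spinCoord, h1, hy]

/-- Linear maps on the spin module are determined by their values at `1` and `y`. -/
theorem linearMap_ext {f f' : SpinModule →ₗ[ℂ] SpinModule} (h1 : f 1 = f' 1)
    (hy : f (ExteriorAlgebra.ι ℂ (1 : ℂ)) = f' (ExteriorAlgebra.ι ℂ (1 : ℂ))) : f = f' := by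
  refine LinearMap.ext fun s => ?_
  obtain ⟨a, b, rfl⟩ := exists_eq_smul_one_add_smul_y s
  simp only [map_add, map_smul, h1, hy]

@[simp] theorem gradeSign_one : gradeSign 1 = 1 :=
  map_one (CliffordAlgebra.involute (Q := (0 : QuadraticForm ℂ ℂ)))

@[simp] theorem gradeSign_y :
    gradeSign (ExteriorAlgebra.ι ℂ (1 : ℂ)) = -ExteriorAlgebra.ι ℂ (1 : ℂ) :=
  CliffordAlgebra.involute_ι _

@[simp] theorem wedgeY_one : wedgeY 1 = ExteriorAlgebra.ι ℂ (1 : ℂ) := mul_one _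

@[simp] theorem wedgeY_y : wedgeY (ExteriorAlgebra.ι ℂ (1 : ℂ)) = 0 :=
  ExteriorAlgebra.ι_sq_zero _

@[simp] theorem contractX_one : contractX 1 = 0 :=
  CliffordAlgebra.contractLeft_one (Q := (0 : QuadraticForm ℂ ℂ)) LinearMap.id

@[simp] theorem contractX_y : contractX (ExteriorAlgebra.ι ℂ (1 : ℂ)) = 1 :=
  (CliffordAlgebra.contractLeft_ι (Q := (0 : QuadraticForm ℂ ℂ)) LinearMap.id 1).trans
    (map_one (algebraMap ℂ SpinModule))

/-- This product and the next two express that the volume element `e₁ · e₂ · e₃` acts as `-1`, so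
bivectors act as vectors. -/
theorem gammaMap_zero_comp_one : gammaMap 0 ∘ₗ gammaMap 1 = gammaMap 2 := by
  apply linearMap_ext <;> simp [gammaMap, smul_smul]

theorem gammaMap_zero_comp_two : gammaMap 0 ∘ₗ gammaMap 2 = -gammaMap 1 := by
  apply linearMap_ext <;> simp [gammaMap]

theorem gammaMap_one_comp_two : gammaMap 1 ∘ₗ gammaMap 2 = gammaMap 0 := by
  apply linearMap_ext <;> simp [gammaMap]

/-- The Clifford relation `v · v · s = -|v|² s`, in coordinates. -/
theorem sum_smul_gammaMap_sq (c : Fin 3 → ℂ) (s : SpinModule) :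
    ∑ i, c i • gammaMap i (∑ j, c j • gammaMap j s) = -(∑ i, c i ^ 2) • s := by
  have h : (∑ i, c i • gammaMap i) ∘ₗ (∑ i, c i • gammaMap i) =
      -(∑ i, c i ^ 2) • LinearMap.id := by
    apply linearMap_ext <;>
    · simp only [Fin.sum_univ_three, gammaMap, Matrix.cons_val_zero, Matrix.cons_val_one,
        Matrix.cons_val, LinearMap.comp_apply, LinearMap.add_apply, LinearMap.smul_apply,
        LinearMap.sub_apply, map_add, map_sub, map_smul, map_neg, gradeSign_one, gradeSign_y,
        wedgeY_one, wedgeY_y, contractX_one, contractX_y, map_zero, LinearMap.id_apply]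
      -- The correction by `I ^ 2 = -1` comes from the factor `I` in the actions of `e₁` and `e₂`;
      -- that of `e₃` has none.
      match_scalars <;> first | ring1 | linear_combination (c 0 ^ 2 + c 1 ^ 2) * Complex.I_sq
  simpa [LinearMap.sum_apply] using LinearMap.congr_fun h s

/-- A nonzero real vector acts injectively on spinors. -/
theorem eq_zero_of_sum_smul_gammaMap_eq_zero {c : Fin 3 → ℝ} {s : SpinModule} (hs : s ≠ 0)
    (h : ∑ i, (c i : ℂ) • gammaMap i s = 0) : c = 0 := by
  have h2 := sum_smul_gammaMap_sq (fun i => (c i : ℂ)) s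
  simp only [h, map_zero, smul_zero, Finset.sum_const_zero] at h2
  have h3 : ∑ i, (c i : ℂ) ^ 2 = 0 := by simpa [hs] using h2.symm
  -- Reality of `c` is essential here: a non-zero complex vector can be isotropic and annihilate a
  -- spinor.
  have h4 : ∑ i, c i ^ 2 = 0 := by exact_mod_cast h3
  ext i
  have := (Finset.sum_eq_zero_iff_of_nonneg fun i _ => sq_nonneg (c i)).1 h4 i (Finset.mem_univ i)
  simpa using this

/-- The spin lift of an element of `𝔰𝔬(3)` acts as Clifford multiplication by a real vector. -/
theorem half_sum_gammaMap_gammaMap (w : Fin 3 → Fin 3 → ℝ) (s : SpinModule) :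
    (1 / 2 : ℂ) • ∑ i : Fin 3, ∑ j ∈ Finset.Ioi i, (w i j : ℂ) • gammaMap i (gammaMap j s) =
      ∑ i, ((![w 1 2 / 2, -w 0 2 / 2, w 0 1 / 2] i : ℝ) : ℂ) • gammaMap i s := by
  have h01 := LinearMap.congr_fun gammaMap_zero_comp_one s
  have h02 := LinearMap.congr_fun gammaMap_zero_comp_two s
  have h12 := LinearMap.congr_fun gammaMap_one_comp_two s
  simp only [LinearMap.comp_apply, LinearMap.neg_apply] at h01 h02 h12
  have i0 : Finset.Ioi (0 : Fin 3) = {1, 2} := by decide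
  have i1 : Finset.Ioi (1 : Fin 3) = {2} := by decide
  have i2 : Finset.Ioi (2 : Fin 3) = ∅ := by decide
  simp only [Fin.sum_univ_three, i0, i1, i2, Finset.sum_empty, Finset.sum_singleton,
    Finset.sum_pair (show (1 : Fin 3) ≠ 2 by decide), h01, h02, h12, Matrix.cons_val_zero,
    Matrix.cons_val_one, Matrix.cons_val]
  push_cast
  module

theorem isInvariantSpinor_iff {G : Type*} [Group G] {ψ : G → SpinModule} :
    IsInvariantSpinor ψ ↔ ∃ s, ψ = fun _ => s := by
  refine ⟨fun h => ⟨ψ 1, funext fun x => ?_⟩, ?_⟩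
  -- Translating by `x⁻¹` and evaluating at `1` gives `ψ x = ψ 1`.
  · simpa [translate] using congrFun (h x⁻¹) 1
  · rintro ⟨s, rfl⟩ x
    rfl

section Group

variable {G : Type*} [TopologicalSpace G] [ChartedSpace (EuclideanSpace ℝ (Fin 3)) G] [Group G]
  [LieGroup (𝓡 3) ∞ G]

/-- The order of quantifiers is the point: `b` depends on `x` and `v` but not on the spinor. -/
theorem spinConnection_const (g : Metric G) (D : Connection G)
    (e : Fin 3 → GroupLieAlgebra (𝓡 3) G) (x : G) (v : TangentSpace (𝓡 3) x) :
    ∃ b : Fin 3 → ℝ, ∀ s : SpinModule,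
      spinConnection g D e (fun _ => s) x v = ∑ i, (b i : ℂ) • gammaMap i s := by
  let w : Fin 3 → Fin 3 → ℝ := fun i j => g.inner x (D (frame e i) x v) (frame e j x)
  refine ⟨![w 1 2 / 2, -w 0 2 / 2, w 0 1 / 2], fun s => ?_⟩
  rw [← half_sum_gammaMap_gammaMap w, spinConnection, spinorDeriv, mfderiv_const]
  exact zero_add _

/-- The endomorphism of an invariant generalised Killing spinor that does not vanish serves every
invariant spinor. -/
theorem IsGeneralisedKilling.const {g : Metric G} {D : Connection G}
    {e : Fin 3 → GroupLieAlgebra (𝓡 3) G} {A : EndField G} {s : SpinModule} (hs : s ≠ 0)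
    (h : IsGeneralisedKilling g D e (fun _ => s) A) (t : SpinModule) :
    IsGeneralisedKilling g D e (fun _ => t) A where
  smooth_spinor := contMDiff_const
  smooth_endo := h.smooth_endo
  symmetric := h.symmetric
  equation x v := by
    obtain ⟨b, hb⟩ := spinConnection_const g D e x v
    have hx := h.equation x v
    rw [hb, cliffordMul, ← sub_eq_zero, ← Finset.sum_sub_distrib] at hx
    -- The components of `b(v) - A(v)`, a real vector annihilating `s ≠ 0`.
    have hc := eq_zero_of_sum_smul_gammaMap_eq_zero
      (c := fun i => b i - g.inner x (A x v) (frame e i x)) hs (by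
        simpa only [Complex.ofReal_sub, sub_smul] using hx)
    rw [hb, cliffordMul]
    refine Finset.sum_congr rfl fun i _ => ?_
    rw [sub_eq_zero.1 (congrFun hc i)]

/-- Ensures that the solution set contains `0` even when no non-zero invariant spinor is a solution.
-/
theorem isGeneralisedKilling_zero (g : Metric G) (D : Connection G)
    (e : Fin 3 → GroupLieAlgebra (𝓡 3) G) :
    IsGeneralisedKilling g D e (fun _ => 0) (fun _ => 0) where
  smooth_spinor := contMDiff_const
  smooth_endo := Bundle.contMDiff_zeroSection ℝ
    (fun x : G => TangentSpace (𝓡 3) x →L[ℝ] TangentSpace (𝓡 3) x)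
  symmetric x v w := by simp
  equation x v := by
    obtain ⟨b, hb⟩ := spinConnection_const g D e x v
    simp [hb, cliffordMul]

end Group

end LieSpin

open LieSpin in
theorem lemma4p1
    {G : Type*} [TopologicalSpace G] [ChartedSpace (EuclideanSpace ℝ (Fin 3)) G] [Group G]
    [LieGroup (𝓡 3) ∞ G]
    (g : Metric G) (hg : IsLeftInvariantMetric g)
    (D : Connection G) (hD : IsLeviCivita g D)
    (e : Fin 3 → GroupLieAlgebra (𝓡 3) G) (he : IsOrthonormal g e) :
    (∀ A : EndField G,
      (∃ ψ : G → SpinModule,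
        IsInvariantSpinor ψ ∧ ψ ≠ 0 ∧ IsGeneralisedKilling g D e ψ A) →
      ∀ φ : G → SpinModule, IsInvariantSpinor φ → IsGeneralisedKilling g D e φ A) ∧
    ∃ W : Submodule ℂ SpinModule,
      (∀ ψ : G → SpinModule,
        (IsInvariantSpinor ψ ∧ ∃ A : EndField G, IsGeneralisedKilling g D e ψ A) ↔
          ∃ s ∈ W, ψ = fun _ => s) ∧
      (W = ⊥ ∨ W = ⊤) := by
  have key : ∀ A : EndField G,
      (∃ ψ : G → SpinModule,
        IsInvariantSpinor ψ ∧ ψ ≠ 0 ∧ IsGeneralisedKilling g D e ψ A) →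
      ∀ φ : G → SpinModule, IsInvariantSpinor φ → IsGeneralisedKilling g D e φ A := by
    rintro A ⟨ψ, hψ, h0, hA⟩ φ hφ
    obtain ⟨s, rfl⟩ := isInvariantSpinor_iff.1 hψ
    obtain ⟨t, rfl⟩ := isInvariantSpinor_iff.1 hφ
    exact hA.const (fun hs => h0 (funext fun _ => hs)) t
  refine ⟨key, ?_⟩
  -- One non-zero solution gives `W = ⊤` by `key`; otherwise only the zero spinor remains.
  by_cases H : ∃ A : EndField G, ∃ ψ : G → SpinModule,
      IsInvariantSpinor ψ ∧ ψ ≠ 0 ∧ IsGeneralisedKilling g D e ψ A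
  · obtain ⟨A, hA⟩ := H
    refine ⟨⊤, fun ψ => ⟨fun h => ?_, ?_⟩, Or.inr rfl⟩
    · obtain ⟨s, hs⟩ := isInvariantSpinor_iff.1 h.1
      exact ⟨s, Submodule.mem_top, hs⟩
    · rintro ⟨s, -, hs⟩
      have hψ := isInvariantSpinor_iff.2 ⟨s, hs⟩
      exact ⟨hψ, A, key A hA ψ hψ⟩
  · refine ⟨⊥, fun ψ => ⟨?_, ?_⟩, Or.inl rfl⟩
    · rintro ⟨hψ, A, hA⟩
      refine ⟨0, Submodule.zero_mem _, ?_⟩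
      by_contra h0
      exact H ⟨A, ψ, hψ, h0, hA⟩
    · rintro ⟨s, hs, rfl⟩
      obtain rfl := (Submodule.mem_bot ℂ).1 hs
      exact ⟨isInvariantSpinor_iff.2 ⟨0, rfl⟩, _, isGeneralisedKilling_zero g D e⟩
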